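/- Let $n$ be a natural number, $\mu_0\in\mathbb R^n$, $\alpha_\mu>0$, $\alpha_W>n-1$, and let $T_0$ be a real symmetric positive definite $n\times n$ matrix. Let $(\mu,W)$ be a random vector in $\mathbb R^n$ together with a random symmetric positive definite $n\times n$ matrix that have the normal–Wishart distribution with these constants: $W$ has the Wishart density $$p(W)=c\,|W|^{(\alpha_W-n-1)/2}\,e^{-\frac12\operatorname{tr}(T_0W)}$$ on the positive definite matrices (with respect to Lebesgue measure in the $n(n+1)/2$ free entries of $W$, with $c$ the normalizing constant), and, given $W$, $\mu$ is multivariate normal with mean $\mu_0$ and precision matrix $\alpha_\mu W$. The regression parameters of the complete Gaussian network with ordering $X_1,\dots,X_n$ that corresponds to the normal distribution with mean $\mu$ and precision matrix $W$ are the intercepts $m=(m_1,\dots,m_n)$, the conditional variances $v=(v_1,\dots,v_n)$ with all $v_i>0$, and the coefficient vectors $B=(b_1,\dots,b_n)$, $b_i=(b_{1i},\dots,b_{i-1,i})'\in\mathbb R^{i-1}$, for which $$\mu_i=m_i+\sum_{j=1}^{i-1}b_{ji}\mu_j\quad(1\le i\le n)$$ and $W=W(n)$, where $W(1),\dots,W(n)$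 are given by the Shachter–Kenley recursion $$W(1)=\frac1{v_1},\qquad W(i+1)=\begin{pmatrix}W(i)+\dfrac{b_{i+1}b_{i+1}'}{v_{i+1}}&-\dfrac{b_{i+1}}{v_{i+1}}\\[2mm]-\dfrac{b_{i+1}'}{v_{i+1}}&\dfrac1{v_{i+1}}\end{pmatrix}\quad(1\le i<n).$$ Then, almost surely, there is exactly one such $(m,v,B)$, and the triples $(m_1,v_1,b_1),\dots,(m_n,v_n,b_n)$ are mutually independent random vectors. Moreover, $(m,v,B)$ and each $(m_i,v_i,b_i)$ have densities with respect to Lebesgue measure, and $$p(m,v,B)=\prod_{i=1}^n p(m_i,v_i,b_i)$$ almost everywhere. -/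

import Mathlib

open MeasureTheory ProbabilityTheory

noncomputable section

/-- Parameters `(m_i, v_i, b_i)` of the local linear regression of the `i`-th variable on its
predecessors: intercept, conditional variance, and one coefficient `b_{ji}` for every `j < i`
(indices start at `0`, so that the `i`-th variable has exactly `i` predecessors). -/
abbrev NodeParam {n : ℕ} (i : Fin n) : Type := ℝ × ℝ × (Fin (i : ℕ) → ℝ)

/-- Parameters `(m, v, B)` of the complete Gaussian network with ordering `X_0, …, X_{n-1}`. -/
abbrev NetParam (n : ℕ) : Type := (i : Fin n) → NodeParam i

namespace NetParam

variable {n : ℕ}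

/-- The intercept `m_i`. -/
def m (θ : NetParam n) (i : Fin n) : ℝ := (θ i).1

/-- The conditional variance `v_i`. -/
def v (θ : NetParam n) (i : Fin n) : ℝ := (θ i).2.1

/-- The coefficient vector `b_i = (b_{ji})_{j < i}`. -/
def b (θ : NetParam n) (i : Fin n) : Fin (i : ℕ) → ℝ := (θ i).2.2

end NetParam

/-- The precision matrix determined by conditional variances `v` and regression coefficients `b`,
by the recursion
`W(k+1) = [[W(k) + b bᵀ / v, -b / v], [-bᵀ / v, 1 / v]]` where `b, v` belong to the last variable.
It starts from the empty matrix, so that the `1 × 1` matrix `W(1)` has the entry `1 / v_0`. -/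
def precisionOfRegression :
    (k : ℕ) → (Fin k → ℝ) → ((i : Fin k) → Fin (i : ℕ) → ℝ) → Matrix (Fin k) (Fin k) ℝ
  | 0, _, _ => 0
  | k + 1, v, b =>
    let vk : ℝ := v (Fin.last k)
    let bk : Fin k → ℝ := b (Fin.last k)
    Matrix.reindex finSumFinEquiv finSumFinEquiv
      (Matrix.fromBlocks
        (precisionOfRegression k (fun i => v i.castSucc) (fun i => b i.castSucc)
          + vk⁻¹ • Matrix.vecMulVec bk bk)
        (Matrix.replicateCol (Fin 1) (-(vk⁻¹ • bk)))
        (Matrix.replicateRow (Fin 1) (-(vk⁻¹ • bk)))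
        (Matrix.of fun _ _ : Fin 1 => vk⁻¹))

/-- `θ = (m, v, B)` are the regression parameters of the normal distribution with mean `μ` and
precision matrix `W`: the conditional variances are positive,
`μ_i = m_i + ∑_{j < i} b_{ji} μ_j` for all `i`, and `W` is the matrix that the recursion
produces from `(v, B)`. -/
structure IsRegressionParam {n : ℕ} (μ : Fin n → ℝ) (W : Matrix (Fin n) (Fin n) ℝ)
    (θ : NetParam n) : Prop where
  v_pos : ∀ i, 0 < θ.v i
  mean_eq : ∀ i, μ i = θ.m i + ∑ j : Fin (i : ℕ), θ.b i j * μ (Fin.castLE i.isLt.le j)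
  precision_eq : W = precisionOfRegression n θ.v θ.b

/-- The symmetric matrix with entry `w s(i, j)` at `(i, j)` and `(j, i)`. Through it, Lebesgue
measure on `Sym2 (Fin n) → ℝ` is Lebesgue measure in the `n (n + 1) / 2` free entries (diagonal and
upper triangle) of a symmetric matrix. -/
def symMatrix {n : ℕ} (w : Sym2 (Fin n) → ℝ) : Matrix (Fin n) (Fin n) ℝ :=
  Matrix.of fun i j => w s(i, j)

/-- The density at `x` of the `n`-dimensional normal distribution with mean `μ₀` and (positive
definite) precision matrix `Λ`. -/
def normalDensity {n : ℕ} (μ₀ : Fin n → ℝ) (Λ : Matrix (Fin n) (Fin n) ℝ) (x : Fin n → ℝ) : ℝ :=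
  (2 * Real.pi) ^ (-(n : ℝ) / 2) * Λ.det ^ (1 / 2 : ℝ) *
    Real.exp (-(1 / 2) * ((x - μ₀) ⬝ᵥ (Matrix.mulVec Λ (x - μ₀))))

/-- The normalizing constant
`|T|^(α/2) / (2^(n α / 2) π^(n (n-1) / 4) ∏_{i=1}^n Γ((α + 1 - i) / 2))` of the Wishart density. -/
def wishartConst {n : ℕ} (α : ℝ) (T : Matrix (Fin n) (Fin n) ℝ) : ℝ :=
  T.det ^ (α / 2) /
    ((2 : ℝ) ^ ((n : ℝ) * α / 2) * Real.pi ^ ((n : ℝ) * ((n : ℝ) - 1) / 4) *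
      ∏ i : Fin n, Real.Gamma ((α - (i : ℕ)) / 2))

/-- The density `c |W|^((α - n - 1) / 2) exp (-tr (T W) / 2)`, at a positive definite matrix `W`,
of the Wishart distribution with `α` degrees of freedom and matrix `T`. -/
def wishartDensity {n : ℕ} (α : ℝ) (T W : Matrix (Fin n) (Fin n) ℝ) : ℝ :=
  wishartConst α T * W.det ^ ((α - (n : ℝ) - 1) / 2) * Real.exp (-(1 / 2) * (T * W).trace)

/-- The normal–Wishart distribution of a pair `(μ, W)` in free coordinates of `W`: it lives on the
positive definite `W`, with density `p(μ | W) p(W)`, where `p(μ | W)` is normal with mean `μ₀` and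
precision matrix `αμ W`, and `p(W)` is Wishart with `αW` degrees of freedom and matrix `T₀`. -/
def normalWishartCoord {n : ℕ} (μ₀ : Fin n → ℝ) (αμ αW : ℝ) (T₀ : Matrix (Fin n) (Fin n) ℝ) :
    Measure ((Fin n → ℝ) × (Sym2 (Fin n) → ℝ)) :=
  volume.withDensity
    (Set.indicator {p | (symMatrix p.2).PosDef} fun p =>
      ENNReal.ofReal
        (normalDensity μ₀ (αμ • symMatrix p.2) p.1 * wishartDensity αW T₀ (symMatrix p.2)))

/-- The product (Borel) σ-algebra on real matrices: the one generated by the entries. -/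
instance matrixMeasurableSpace (n : ℕ) : MeasurableSpace (Matrix (Fin n) (Fin n) ℝ) :=
  inferInstanceAs (MeasurableSpace (Fin n → Fin n → ℝ))

/-- The normal–Wishart distribution, as a distribution of a vector and a matrix. -/
def normalWishart {n : ℕ} (μ₀ : Fin n → ℝ) (αμ αW : ℝ) (T₀ : Matrix (Fin n) (Fin n) ℝ) :
    Measure ((Fin n → ℝ) × Matrix (Fin n) (Fin n) ℝ) :=
  (normalWishartCoord μ₀ αμ αW T₀).map fun p => (p.1, symMatrix p.2)

end

/-! The map from `(m, v, B)` to the mean and the free entries of the precision matrix is built one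
node at a time. With `s = 1/v` and `r = -b/v`, adding a node with parameters `(m, v, b)` borders `W`
by the column `r` and the corner `s`, after two shears: `W` is translated by `r r' / s = b b' / v`,
and the new mean is `m` translated by `b ⬝ᵥ μ`. Shears preserve Lebesgue measure, so only `(v, b) ↦
(s, r)` has a Jacobian, `v ^ (-(i+2))` for a node with `i` predecessors. It involves that node
alone. By Schur complements, positive definiteness of the result means `v > 0` at every node. Hence
Lebesgue measure on means and positive definite matrices is the image of a product measure over the
nodes (`measurePreserving_netCoord`).

The normal–Wishart density factors over the nodes too: `det W = ∏ 1/v_i`, while `tr (T₀ W)` and the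
quadratic form of `W` at `μ - μ₀` are sums whose `i`-th term depends on `(m_i, v_i, b_i)` only. So
the distribution is the image of a multiple of a product measure (`normalWishart_eq_map`). Its total
mass is 1, so every factor can be normalized to a probability without evaluating any constant
(`exists_smul_pi_eq_pi`).

The parametrization is injective where all `v_i > 0` (`netNormal_injOn`) and has a measurable left
inverse there. Almost surely the parameters are therefore unique and their law is the product
measure, which gives independence and the densities. -/

/-! ### Bordered matrices: positivity, determinant, trace -/

/-- The square matrix obtained from `A` by appending the row and column `r` with corner `s`. -/
def borderMatrix {n : ℕ} (A : Matrix (Fin n) (Fin n) ℝ) (r : Fin n → ℝ) (s : ℝ) :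
    Matrix (Fin (n + 1)) (Fin (n + 1)) ℝ :=
  Matrix.reindex finSumFinEquiv finSumFinEquiv
    (Matrix.fromBlocks A (Matrix.replicateCol (Fin 1) r) (Matrix.replicateRow (Fin 1) r)
      (Matrix.of fun _ _ : Fin 1 => s))

namespace borderMatrix

variable {n : ℕ} (A : Matrix (Fin n) (Fin n) ℝ) (r : Fin n → ℝ) (s : ℝ)

@[simp]
theorem castSucc_castSucc (i j : Fin n) :
    borderMatrix A r s i.castSucc j.castSucc = A i j := by
  simp [borderMatrix]

@[simp]
theorem castSucc_last (i : Fin n) : borderMatrix A r s i.castSucc (Fin.last n) = r i := by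
  simp [borderMatrix]

@[simp]
theorem last_castSucc (j : Fin n) : borderMatrix A r s (Fin.last n) j.castSucc = r j := by
  simp [borderMatrix]

@[simp]
theorem last_last : borderMatrix A r s (Fin.last n) (Fin.last n) = s := by
  simp [borderMatrix]

theorem isHermitian_iff : (borderMatrix A r s).IsHermitian ↔ A.IsHermitian := by
  simp [Matrix.isHermitian_iff_isSymm, Matrix.IsSymm.ext_iff, Fin.forall_fin_succ']

theorem dotProduct_mulVec (x : Fin n → ℝ) (y : ℝ) :
    (Fin.snoc x y : Fin (n + 1) → ℝ) ⬝ᵥ (borderMatrix A r s).mulVec (Fin.snoc x y) =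
      x ⬝ᵥ A.mulVec x + 2 * y * (r ⬝ᵥ x) + s * y ^ 2 := by
  simp only [dotProduct, Matrix.mulVec, Fin.sum_univ_castSucc, Fin.snoc_castSucc, Fin.snoc_last,
    castSucc_castSucc, castSucc_last, last_castSucc, last_last, mul_add, Finset.sum_add_distrib]
  have h : ∑ i, x i * (r i * y) = y * ∑ i, r i * x i := by
    rw [Finset.mul_sum]
    exact Finset.sum_congr rfl fun i _ => by ring
  rw [h]
  ring

theorem dotProduct_vecMulVec_mulVec (x : Fin n → ℝ) :
    x ⬝ᵥ (Matrix.vecMulVec r r).mulVec x = (r ⬝ᵥ x) ^ 2 := by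
  rw [Matrix.vecMulVec_mulVec, dotProduct_smul, dotProduct_comm x r]
  simp [sq]

/-- Completing the square: the form at `(x, y)` is that of `A` at `x` plus `s * (y + s⁻¹ * (r ⬝ᵥ x))
^ 2`. -/
theorem posDef_add_iff (hs : 0 < s) :
    (borderMatrix (A + s⁻¹ • Matrix.vecMulVec r r) r s).PosDef ↔ A.PosDef := by
  have hquad (x : Fin n → ℝ) (y : ℝ) : (Fin.snoc x y : Fin (n + 1) → ℝ) ⬝ᵥ
      (borderMatrix (A + s⁻¹ • Matrix.vecMulVec r r) r s).mulVec (Fin.snoc x y) =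
      x ⬝ᵥ A.mulVec x + s * (y + s⁻¹ * (r ⬝ᵥ x)) ^ 2 := by
    rw [dotProduct_mulVec, Matrix.add_mulVec, Matrix.smul_mulVec, dotProduct_add, dotProduct_smul,
      dotProduct_vecMulVec_mulVec, smul_eq_mul]
    field_simp
    ring
  have hherm : (s⁻¹ • Matrix.vecMulVec r r).IsHermitian := by
    simp [Matrix.isHermitian_iff_isSymm, Matrix.IsSymm.ext_iff, Matrix.vecMulVec_apply, mul_comm]
  rw [Matrix.posDef_iff_dotProduct_mulVec, Matrix.posDef_iff_dotProduct_mulVec, isHermitian_iff]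
  refine and_congr ⟨fun h => by simpa using h.sub hherm, fun h => h.add hherm⟩
    ⟨fun h x hx => ?_, fun h z hz => ?_⟩
  -- This last coordinate makes the square vanish.
  · have := @h (Fin.snoc x (-(s⁻¹ * (r ⬝ᵥ x)))) fun h0 => hx <| by
      ext i
      simpa using congrFun h0 i.castSucc
    rw [star_trivial, hquad] at this
    simpa using this
  · obtain ⟨x, y, rfl⟩ : ∃ x y, z = Fin.snoc x y := ⟨_, _, (Fin.snoc_init_self z).symm⟩
    rw [star_trivial, hquad]
    by_cases hx : x = 0
    · have hy : y ≠ 0 := by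
        rintro rfl
        refine hz (funext fun i => ?_)
        refine Fin.lastCases ?_ (fun i => ?_) i <;> simp [hx]
      subst hx
      simp
      positivity
    · have := @h x hx
      rw [star_trivial] at this
      positivity

theorem posDef_iff : (borderMatrix A r s).PosDef ↔
    0 < s ∧ (A - s⁻¹ • Matrix.vecMulVec r r).PosDef := by
  refine ⟨fun h => ?_, fun h => ?_⟩
  · have hs : 0 < s := by simpa using h.diag_pos (i := Fin.last n)
    refine ⟨hs, (posDef_add_iff _ r s hs).1 ?_⟩
    simpa using h
  · simpa using (posDef_add_iff _ r s h.1).2 h.2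

/-- `A` is the Schur complement of the corner `s`. -/
theorem det_add (hs : s ≠ 0) :
    (borderMatrix (A + s⁻¹ • Matrix.vecMulVec r r) r s).det = s * A.det := by
  let D : Matrix (Fin 1) (Fin 1) ℝ := Matrix.of fun _ _ => s
  let D' : Matrix (Fin 1) (Fin 1) ℝ := Matrix.of fun _ _ => s⁻¹
  let _ : Invertible D := ⟨D',
    by ext i j; rw [Subsingleton.elim i j]; simp [D, D', Matrix.mul_apply, hs],
    by ext i j; rw [Subsingleton.elim i j]; simp [D, D', Matrix.mul_apply, hs]⟩
  rw [borderMatrix, Matrix.det_reindex_self]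
  change (Matrix.fromBlocks _ _ _ D).det = _
  rw [Matrix.det_fromBlocks₂₂]
  congr 1
  · simp [D]
  · congr 1
    ext i j
    change A i j + s⁻¹ * Matrix.vecMulVec r r i j - (_ * D' * _ : Matrix _ _ ℝ) i j = _
    simp [D', Matrix.mul_apply, Matrix.vecMulVec_apply]
    ring

theorem trace_mul (T : Matrix (Fin (n + 1)) (Fin (n + 1)) ℝ) :
    (T * borderMatrix A r s).trace =
      (Matrix.of (fun i j : Fin n => T i.castSucc j.castSucc) * A).trace +
        ∑ i, (T (Fin.last n) i.castSucc + T i.castSucc (Fin.last n)) * r i +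
        T (Fin.last n) (Fin.last n) * s := by
  simp only [Matrix.trace, Matrix.diag_apply, Matrix.mul_apply, Fin.sum_univ_castSucc,
    castSucc_castSucc, castSucc_last, last_castSucc, last_last, Matrix.of_apply,
    Finset.sum_add_distrib, add_mul]
  ring

end borderMatrix

/-! ### Products of measures with densities -/

theorem lintegral_fin_prod_eq_prod {n : ℕ} {E : Fin n → Type*} {mE : ∀ i, MeasurableSpace (E i)}
    (κ : (i : Fin n) → Measure (E i)) [∀ i, SigmaFinite (κ i)]
    {f : (i : Fin n) → E i → ENNReal} (hf : ∀ i, Measurable (f i)) :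
    ∫⁻ x : (i : Fin n) → E i, ∏ i, f i (x i) ∂(Measure.pi κ) = ∏ i, ∫⁻ x, f i x ∂(κ i) := by
  induction n with
  | zero => simp
  | succ n ih =>
    rw [← ((measurePreserving_piFinSuccAbove κ 0).symm).lintegral_comp_emb
      (MeasurableEquiv.measurableEmbedding _)]
    have h (x : E 0 × ((i : Fin n) → E (Fin.succ i))) :
        ∏ i, f i ((MeasurableEquiv.piFinSuccAbove E 0).symm x i) =
          f 0 x.1 * ∏ i : Fin n, f i.succ (x.2 i) := by
      rw [Fin.prod_univ_succ]
      rfl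
    refine (lintegral_congr h).trans ?_
    refine (lintegral_prod_mul (ν := Measure.pi fun i : Fin n => κ i.succ)
      (g := fun y => ∏ i : Fin n, f i.succ (y i)) (hf 0).aemeasurable ?_).trans ?_
    · exact (Finset.measurable_prod _ fun i _ => (hf _).comp (measurable_pi_apply i)).aemeasurable
    · rw [ih (fun i => κ i.succ) fun i => hf i.succ, Fin.prod_univ_succ]

/-- It suffices to compare on boxes, where indicator times density is a product of functions of
single coordinates and Tonelli applies. -/
theorem pi_withDensity_eq {n : ℕ} {E : Fin n → Type*} {mE : ∀ i, MeasurableSpace (E i)}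
    (κ : (i : Fin n) → Measure (E i)) [∀ i, SigmaFinite (κ i)]
    {f : (i : Fin n) → E i → ENNReal} (hf : ∀ i, Measurable (f i))
    [∀ i, SigmaFinite ((κ i).withDensity (f i))] :
    Measure.pi (fun i => (κ i).withDensity (f i)) =
      (Measure.pi κ).withDensity fun x => ∏ i, f i (x i) := by
  refine Measure.pi_eq fun s hs => ?_
  rw [withDensity_apply _ (.univ_pi hs), ← lintegral_indicator (.univ_pi hs)]
  have h (x : (i : Fin n) → E i) : (Set.univ.pi s).indicator (fun x => ∏ i, f i (x i)) x =
      ∏ i, (s i).indicator (f i) (x i) := by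
    by_cases hx : x ∈ Set.univ.pi s
    · rw [Set.indicator_of_mem hx]
      exact Finset.prod_congr rfl fun i _ => (Set.indicator_of_mem (hx i trivial) _).symm
    · obtain ⟨i, hi⟩ : ∃ i, x i ∉ s i := by simpa using hx
      rw [Set.indicator_of_notMem hx]
      exact (Finset.prod_eq_zero (Finset.mem_univ i) (Set.indicator_of_notMem hi _)).symm
  rw [lintegral_congr h, lintegral_fin_prod_eq_prod κ fun i => (hf i).indicator (hs i)]
  exact Finset.prod_congr rfl fun i _ => by
    rw [withDensity_apply _ (hs i), lintegral_indicator (hs i)]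

/-! ### Change of variables at a single node -/

theorem lintegral_Ioi_inv (g : ℝ → ENNReal) :
    ∫⁻ v in Set.Ioi (0 : ℝ), ENNReal.ofReal (v⁻¹ ^ 2) * g v⁻¹ = ∫⁻ s in Set.Ioi (0 : ℝ), g s := by
  have himg : (fun v : ℝ => v⁻¹) '' Set.Ioi 0 = Set.Ioi 0 := by
    ext s
    refine ⟨?_, fun hs => ⟨s⁻¹, Set.mem_Ioi.2 (inv_pos.2 hs), inv_inv s⟩⟩
    rintro ⟨v, hv, rfl⟩
    exact Set.mem_Ioi.2 (inv_pos.2 hv)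
  have h := lintegral_image_eq_lintegral_abs_deriv_mul (f := fun v : ℝ => v⁻¹)
    (f' := fun v => -(v ^ 2)⁻¹) measurableSet_Ioi
    (fun v hv => (hasDerivAt_inv (ne_of_gt hv)).hasDerivWithinAt) inv_injective.injOn g
  rw [himg] at h
  rw [h]
  refine lintegral_congr fun v => ?_
  simp

theorem lintegral_comp_smul_pi {n : ℕ} {c : ℝ} (hc : c ≠ 0) {g : (Fin n → ℝ) → ENNReal}
    (hg : Measurable g) :
    ENNReal.ofReal (|c| ^ n) * ∫⁻ b, g (c • b) = ∫⁻ b, g b := by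
  have h := lintegral_map (μ := volume) hg (measurable_const_smul c)
  rw [Measure.map_addHaar_smul _ hc, lintegral_smul_measure, Module.finrank_fin_fun] at h
  rw [← h, smul_eq_mul, ← mul_assoc, ← ENNReal.ofReal_mul (by positivity), abs_inv, abs_pow,
    mul_inv_cancel₀ (by positivity), ENNReal.ofReal_one, one_mul]

/-- The density on `(m, v, b)` whose image under `(m, v, b) ↦ (m, 1 / v, -b / v)` is Lebesgue
measure on the half space of positive second coordinate. -/
noncomputable def nodeJacobian (n : ℕ) : ℝ × ℝ × (Fin n → ℝ) → ENNReal :=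
  {x : ℝ × ℝ × (Fin n → ℝ) | 0 < x.2.1}.indicator fun x => ENNReal.ofReal (x.2.1⁻¹ ^ (n + 2))

theorem measurableSet_node_pos (n : ℕ) : MeasurableSet {x : ℝ × ℝ × (Fin n → ℝ) | 0 < x.2.1} :=
  measurableSet_lt measurable_const (by fun_prop)

theorem measurable_nodeJacobian (n : ℕ) : Measurable (nodeJacobian n) :=
  Measurable.indicator (by fun_prop) (measurableSet_node_pos n)

/-- The measure on `(m, v, b)` whose image under `(m, v, b) ↦ (m, 1 / v, -b / v)` is Lebesgue
measure on the half space of positive second coordinate. -/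
noncomputable def nodeMeasure (n : ℕ) : Measure (ℝ × ℝ × (Fin n → ℝ)) :=
  volume.withDensity (nodeJacobian n)

instance (n : ℕ) : SigmaFinite (nodeMeasure n) := by
  refine SigmaFinite.withDensity_of_ne_top (.of_forall fun x => ?_)
  by_cases hx : 0 < x.2.1 <;> simp [nodeJacobian, hx]

/-- For fixed `m`, the exponent `n + 2` collects `n` from scaling `b` by `-v⁻¹` at fixed `v`, and
`2` from inverting `v`. -/
theorem measurePreserving_node (n : ℕ) :
    MeasurePreserving (fun x : ℝ × ℝ × (Fin n → ℝ) => (x.1, x.2.1⁻¹, -(x.2.1⁻¹ • x.2.2)))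
      (nodeMeasure n) (volume.restrict {x : ℝ × ℝ × (Fin n → ℝ) | 0 < x.2.1}) := by
  have hmeas : Measurable
      (fun x : ℝ × ℝ × (Fin n → ℝ) => (x.1, x.2.1⁻¹, -(x.2.1⁻¹ • x.2.2))) := by fun_prop
  refine ⟨hmeas, Measure.ext_of_lintegral _ fun F hF => ?_⟩
  have hF' : Measurable
      (fun x : ℝ × ℝ × (Fin n → ℝ) => F (x.1, x.2.1⁻¹, -(x.2.1⁻¹ • x.2.2))) := hF.comp hmeas
  rw [lintegral_map hF hmeas, nodeMeasure,
    lintegral_withDensity_eq_lintegral_mul _ (measurable_nodeJacobian n)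
      hF',
    ← lintegral_indicator (measurableSet_node_pos n), Measure.volume_eq_prod,
    lintegral_prod _ ((measurable_nodeJacobian n).mul hF').aemeasurable,
    lintegral_prod _ (hF.indicator (measurableSet_node_pos n)).aemeasurable]
  refine lintegral_congr fun m => ?_
  rw [Measure.volume_eq_prod, lintegral_prod _ (by
      exact (((measurable_nodeJacobian n).mul hF').comp
        measurable_prodMk_left).aemeasurable),
    lintegral_prod _ (by
      exact ((hF.indicator (measurableSet_node_pos n)).comp measurable_prodMk_left).aemeasurable)]
  let H : ℝ → ENNReal := fun s => ∫⁻ b : Fin n → ℝ, F (m, s, b)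
  calc _ = ∫⁻ v : ℝ, (Set.Ioi (0 : ℝ)).indicator
        (fun v => ENNReal.ofReal (v⁻¹ ^ 2) * H v⁻¹) v := by
        refine lintegral_congr fun v => ?_
        by_cases hv : 0 < v
        · have hFm : Measurable fun b : Fin n → ℝ => F (m, v⁻¹, b) := by fun_prop
          have := lintegral_comp_smul_pi (c := -v⁻¹) (by simpa using hv.ne') hFm
          simp only [neg_smul, abs_neg, abs_inv, abs_of_pos hv] at this
          simp only [Pi.mul_apply, nodeJacobian, Set.indicator, Set.mem_Ioi,
            Set.mem_ofPred_eq, hv, if_true, H]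
          rw [lintegral_const_mul _ (by fun_prop), ← this, ← mul_assoc,
            ← ENNReal.ofReal_mul (by positivity), ← pow_add, add_comm 2 n]
        · simp [nodeJacobian, hv]
    _ = ∫⁻ s : ℝ, (Set.Ioi (0 : ℝ)).indicator H s := by
        rw [lintegral_indicator measurableSet_Ioi, lintegral_indicator measurableSet_Ioi,
          lintegral_Ioi_inv H]
    _ = _ := by
        refine lintegral_congr fun s => ?_
        by_cases hs : 0 < s <;> simp [Set.indicator, hs, H]

/-! ### Lebesgue measure in the free entries of a bordered symmetric matrix -/

theorem measurePreserving_prodProdProdComm {α β γ δ : Type*} [MeasureSpace α] [MeasureSpace β]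
    [MeasureSpace γ] [MeasureSpace δ] [SFinite (volume : Measure α)] [SFinite (volume : Measure β)]
    [SFinite (volume : Measure γ)] [SFinite (volume : Measure δ)] :
    MeasurePreserving (fun p : (α × β) × γ × δ => ((p.2.1, p.1.1), (p.1.2, p.2.2))) := by
  have h₁ : MeasurePreserving (fun p : β × γ × δ => (p.2.1, (p.1, p.2.2))) :=
    (volume_preserving_prodAssoc.comp
      (Measure.measurePreserving_swap.prod (MeasurePreserving.id _))).comp
        (volume_preserving_prodAssoc.symm _)
  exact ((Measure.measurePreserving_swap.prod (MeasurePreserving.id _)).comp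
    ((volume_preserving_prodAssoc.symm _).comp
      (((MeasurePreserving.id _).prod h₁)))).comp volume_preserving_prodAssoc

theorem measurePreserving_snoc (n : ℕ) :
    MeasurePreserving (fun p : ℝ × (Fin n → ℝ) => (Fin.snoc p.2 p.1 : Fin (n + 1) → ℝ)) := by
  have h := (volume_preserving_piFinSuccAbove (fun _ : Fin (n + 1) => ℝ) (Fin.last n)).symm
  convert! h using 1
  ext p i
  refine Fin.lastCases ?_ (fun i => ?_) i <;> simp

theorem measurePreserving_sumElim {ι ι' κ : Type*} [Fintype ι] [Fintype ι'] [Fintype κ]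
    (e : ι ⊕ ι' ≃ κ) :
    MeasurePreserving
      (fun (p : (ι → ℝ) × (ι' → ℝ)) (k : κ) => (Sum.elim p.1 p.2 (e.symm k) : ℝ)) := by
  have h := (volume_measurePreserving_piCongrLeft (fun _ : κ => ℝ) e).comp
    ((volume_measurePreserving_sumPiEquivProdPi (fun _ : ι ⊕ ι' => ℝ)).symm)
  convert! h using 1
  ext p k
  obtain ⟨i, rfl⟩ := e.surjective k
  rcases i with i | i <;>
  · simp only [Equiv.symm_apply_apply, Function.comp_apply, MeasurableEquiv.coe_piCongrLeft]
    rw [Equiv.piCongrLeft_apply_apply]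
    rfl

/-- An unordered pair from `Fin (n + 1)` either avoids the last element, or consists of the last
element and an arbitrary one. -/
noncomputable def sym2FinSuccEquiv (n : ℕ) : Sym2 (Fin n) ⊕ Fin (n + 1) ≃ Sym2 (Fin (n + 1)) :=
  Equiv.ofBijective (Sum.elim (Sym2.map Fin.castSucc) fun i => s(i, Fin.last n)) <| by
    refine ⟨?_, fun z => ?_⟩
    · rintro (z | i) (w | j) h
      · exact congrArg Sum.inl (Sym2.map.injective (Fin.castSucc_injective n) h)
      · induction z with | _ a b => simp [Fin.castSucc_ne_last] at h
      · induction w with | _ a b => simp [(Fin.castSucc_ne_last _).symm] at h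
      · rcases Sym2.eq_iff.1 h with ⟨h, -⟩ | ⟨h, h'⟩
        · rw [h]
        · rw [h, h']
    · induction z with | _ i j => ?_
      refine Fin.lastCases ⟨.inr i, rfl⟩ (fun j => ?_) j
      refine Fin.lastCases ⟨.inr j.castSucc, by simp [Sym2.eq_swap]⟩ (fun i => ?_) i
      exact ⟨.inl s(i, j), rfl⟩

/-- The free coordinates of the symmetric matrix obtained by appending the row and column `r`
with corner `s` to the one with free coordinates `w`. -/
noncomputable def borderCoord {n : ℕ} (w : Sym2 (Fin n) → ℝ) (r : Fin n → ℝ) (s : ℝ) :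
    Sym2 (Fin (n + 1)) → ℝ :=
  fun z => Sum.elim w (Fin.snoc r s : Fin (n + 1) → ℝ) ((sym2FinSuccEquiv n).symm z)

theorem symMatrix_borderCoord {n : ℕ} (w : Sym2 (Fin n) → ℝ) (r : Fin n → ℝ) (s : ℝ) :
    symMatrix (borderCoord w r s) = borderMatrix (symMatrix w) r s := by
  have hl (z : Sym2 (Fin n)) : borderCoord w r s (z.map Fin.castSucc) = w z := by
    change Sum.elim _ _ ((sym2FinSuccEquiv n).symm ((sym2FinSuccEquiv n) (.inl z))) = _
    simp
  have hr (i : Fin (n + 1)) :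
      borderCoord w r s s(i, Fin.last n) = (Fin.snoc r s : Fin (n + 1) → ℝ) i := by
    change Sum.elim _ _ ((sym2FinSuccEquiv n).symm ((sym2FinSuccEquiv n) (.inr i))) = _
    simp
  ext i j
  simp only [symMatrix, Matrix.of_apply]
  refine Fin.lastCases ?_ (fun j => ?_) j
  · rw [hr]
    refine Fin.lastCases ?_ (fun i => ?_) i <;> simp
  · refine Fin.lastCases ?_ (fun i => ?_) i
    · rw [Sym2.eq_swap, hr]
      simp
    · rw [← Sym2.map_mk, hl]
      simp

theorem symMatrix_add_vecMulVec {n : ℕ} (w : Sym2 (Fin n) → ℝ) (r : Fin n → ℝ) (c : ℝ) :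
    symMatrix (w + c • fun z => (z.map r).mul) = symMatrix w + c • Matrix.vecMulVec r r := by
  ext i j
  simp [symMatrix, Matrix.vecMulVec_apply]

theorem continuous_symMatrix (n : ℕ) : Continuous (symMatrix (n := n)) :=
  continuous_matrix fun _ _ => continuous_apply _

theorem isHermitian_symMatrix {n : ℕ} (w : Sym2 (Fin n) → ℝ) : (symMatrix w).IsHermitian := by
  rw [Matrix.isHermitian_iff_isSymm]
  ext i j
  simp [symMatrix, Sym2.eq_swap]

/-- Positive definite means positive semidefinite, a closed condition, with nonzero determinant;
this avoids an uncountable intersection of open sets. -/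
theorem measurableSet_posDef_symMatrix (n : ℕ) :
    MeasurableSet {w : Sym2 (Fin n) → ℝ | (symMatrix w).PosDef} := by
  have h : {w : Sym2 (Fin n) → ℝ | (symMatrix w).PosDef} =
      (⋂ x : Fin n → ℝ, {w | 0 ≤ x ⬝ᵥ (symMatrix w).mulVec x}) ∩ {w | (symMatrix w).det ≠ 0} := by
    ext w
    simp only [Set.mem_inter_iff, Set.mem_iInter]
    refine ⟨fun h => ⟨fun x => by simpa using h.posSemidef.dotProduct_mulVec_nonneg x,
      h.det_pos.ne'⟩, fun ⟨h, h'⟩ => ?_⟩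
    exact (Matrix.PosSemidef.of_dotProduct_mulVec_nonneg (isHermitian_symMatrix w)
      (by simpa using h)).posDef_iff_det_ne_zero.2 h'
  have hc := continuous_symMatrix n
  rw [h]
  refine MeasurableSet.inter (IsClosed.measurableSet (isClosed_iInter fun x =>
    isClosed_le continuous_const (by fun_prop))) (measurableSet_eq_fun ?_ measurable_const).compl
  exact (Continuous.matrix_det hc).measurable

/-! ### Adding one node -/

/-- The pair of a mean vector and the free coordinates of a precision matrix. -/
abbrev NormalCoord (n : ℕ) : Type := (Fin n → ℝ) × (Sym2 (Fin n) → ℝ)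

theorem measurePreserving_borderCoord (n : ℕ) :
    MeasurePreserving (fun p : NormalCoord n × ℝ × ℝ × (Fin n → ℝ) =>
      ((Fin.snoc p.1.1 p.2.1, borderCoord p.1.2 p.2.2.2 p.2.2.1) : NormalCoord (n + 1))) :=
  ((measurePreserving_snoc n).prod ((measurePreserving_sumElim (sym2FinSuccEquiv n)).comp
    ((MeasurePreserving.id _).prod (measurePreserving_snoc n)))).comp
      measurePreserving_prodProdProdComm

theorem measurable_sym2_mul (n : ℕ) :
    Measurable fun (r : Fin n → ℝ) (z : Sym2 (Fin n)) => (z.map r).mul := by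
  refine measurable_pi_lambda _ fun z => ?_
  induction z with | _ i j =>
    simp only [Sym2.map_mk, Sym2.mul_mk]
    fun_prop

theorem measurePreserving_add_fst {α β : Type*} [MeasureSpace α] [MeasureSpace β] [AddGroup α]
    [MeasurableAdd₂ α] [SFinite (volume : Measure α)] [SFinite (volume : Measure β)]
    [(volume : Measure α).IsAddRightInvariant] {c : β → α} (hc : Measurable c) :
    MeasurePreserving (fun p : α × β => (p.1 + c p.2, p.2)) :=
  (Measure.measurePreserving_swap.comp
    ((MeasurePreserving.id (volume : Measure β)).skew_product (g := fun x y => y + c x)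
      (μc := volume) (μd := volume) (measurable_snd.add (hc.comp measurable_fst))
      (.of_forall fun _ => map_add_right_eq_self _ _))).comp Measure.measurePreserving_swap

/-- Two shears in succession, each translating one block by a function of the others. At `s = 1/v`,
`r = -b/v` the translations are by `b b' / v` and `b ⬝ᵥ μ`, as the recursion and the mean equation
require. -/
theorem measurePreserving_shear (n : ℕ) :
    MeasurePreserving (fun p : NormalCoord n × ℝ × ℝ × (Fin n → ℝ) =>
      (((p.1.1, p.1.2 + p.2.2.1⁻¹ • fun z => (z.map p.2.2.2).mul),
        (p.2.1 + (-(p.2.2.1⁻¹ • p.2.2.2)) ⬝ᵥ p.1.1, p.2.2)) :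
        NormalCoord n × ℝ × ℝ × (Fin n → ℝ))) := by
  have : (volume : Measure (NormalCoord n)).IsAddRightInvariant :=
    inferInstanceAs ((volume : Measure (Fin n → ℝ)).prod
      (volume : Measure (Sym2 (Fin n) → ℝ))).IsAddRightInvariant
  have hc : Measurable fun x : ℝ × ℝ × (Fin n → ℝ) =>
      ((0, x.2.1⁻¹ • fun z => (z.map x.2.2).mul) : NormalCoord n) :=
    measurable_const.prodMk
      (measurable_snd.fst.inv.smul ((measurable_sym2_mul n).comp measurable_snd.snd))
  have hdot : Measurable fun q : (Fin n → ℝ) × ℝ × (Fin n → ℝ) =>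
      (-(q.2.1⁻¹ • q.2.2)) ⬝ᵥ q.1 := by
    unfold dotProduct
    fun_prop
  have h₂ : MeasurePreserving (fun p : NormalCoord n × ℝ × ℝ × (Fin n → ℝ) =>
      (p.1, (p.2.1 + (-(p.2.2.1⁻¹ • p.2.2.2)) ⬝ᵥ p.1.1, p.2.2))) :=
    (MeasurePreserving.id (volume : Measure (NormalCoord n))).skew_product
      (g := fun p (x : ℝ × ℝ × (Fin n → ℝ)) => (x.1 + (-(x.2.1⁻¹ • x.2.2)) ⬝ᵥ p.1, x.2))
      ((measurable_snd.fst.add (hdot.comp (measurable_fst.fst.prodMk measurable_snd.snd))).prodMk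
        measurable_snd.snd)
      (.of_forall fun p => (measurePreserving_add_fst
        (hdot.comp (measurable_const.prodMk measurable_id))).map_eq)
  convert! h₂.comp (measurePreserving_add_fst hc) using 2 with p
  simp only [Function.comp_apply, Prod.fst_add, add_zero]
  exact Prod.ext (Prod.ext (add_zero _).symm rfl) rfl

/-- The mean and the free coordinates of the precision matrix after adding a variable with
regression parameters `x = (m, v, b)`. -/
noncomputable def addNode {n : ℕ} (p : NormalCoord n) (x : ℝ × ℝ × (Fin n → ℝ)) :
    NormalCoord (n + 1) :=
  (Fin.snoc p.1 (x.1 + x.2.2 ⬝ᵥ p.1),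
    borderCoord (p.2 + x.2.1⁻¹ • fun z => (z.map x.2.2).mul) (-(x.2.1⁻¹ • x.2.2)) x.2.1⁻¹)

theorem measurable_addNode (n : ℕ) :
    Measurable fun q : NormalCoord n × ℝ × ℝ × (Fin n → ℝ) => addNode q.1 q.2 := by
  have hdot : Measurable fun q : (Fin n → ℝ) × (Fin n → ℝ) => q.2 ⬝ᵥ q.1 := by
    unfold dotProduct
    fun_prop
  have h' : Measurable fun q : NormalCoord n × ℝ × ℝ × (Fin n → ℝ) =>
      (((q.1.1, q.1.2 + q.2.2.1⁻¹ • fun z => (z.map q.2.2.2).mul),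
        (q.2.1 + q.2.2.2 ⬝ᵥ q.1.1, q.2.2.1⁻¹, -(q.2.2.1⁻¹ • q.2.2.2))) :
        NormalCoord n × ℝ × ℝ × (Fin n → ℝ)) :=
    (measurable_fst.fst.prodMk (measurable_fst.snd.add (measurable_snd.snd.fst.inv.smul
      ((measurable_sym2_mul n).comp measurable_snd.snd.snd)))).prodMk
      ((measurable_snd.fst.add
        (hdot.comp (measurable_fst.fst.prodMk measurable_snd.snd.snd))).prodMk
      (measurable_snd.snd.fst.inv.prodMk
        (measurable_snd.snd.fst.inv.smul measurable_snd.snd.snd).neg))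
  exact (measurePreserving_borderCoord n).measurable.comp h'

theorem addNode_eq {n : ℕ} (p : NormalCoord n) (m : ℝ) {v : ℝ} (hv : 0 < v) (b : Fin n → ℝ) :
    addNode p (m, v, b) =
      (Fin.snoc p.1 (m + (-((v⁻¹)⁻¹ • (-(v⁻¹ • b)))) ⬝ᵥ p.1),
        borderCoord (p.2 + (v⁻¹)⁻¹ • fun z => (z.map (-(v⁻¹ • b))).mul) (-(v⁻¹ • b)) v⁻¹) := by
  have h₁ : -((v⁻¹)⁻¹ • (-(v⁻¹ • b))) = b := by
    rw [smul_neg, neg_neg, smul_smul, inv_mul_cancel₀ (inv_ne_zero hv.ne'), one_smul]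
  have h₂ : ((v⁻¹)⁻¹ • fun z : Sym2 (Fin n) => (z.map (-(v⁻¹ • b))).mul) =
      v⁻¹ • fun z => (z.map b).mul := by
    ext z
    induction z with | _ i j =>
      simp
      field_simp
  rw [h₁, h₂, addNode]

theorem ae_nodeMeasure_pos (n : ℕ) : ∀ᵐ x ∂nodeMeasure n, 0 < x.2.1 := by
  rw [nodeMeasure, ae_withDensity_iff (measurable_nodeJacobian n)]
  refine .of_forall fun x hx => ?_
  by_contra h
  exact hx (Set.indicator_of_notMem (by simpa using h) _)

/-- The symmetric positive definite matrices, together with a mean vector. -/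
def posDefCoord (n : ℕ) : Set (NormalCoord n) := {p | (symMatrix p.2).PosDef}

theorem measurableSet_posDefCoord (n : ℕ) : MeasurableSet (posDefCoord n) :=
  measurable_snd (measurableSet_posDef_symMatrix n)

/-- The node substitution, the shears and the bordering compose to `addNode`. By the Schur
complement, positive definite bordered matrices pull back to the product of positive definite
matrices and a positive corner. -/
theorem measurePreserving_addNode (n : ℕ) :
    MeasurePreserving (fun q : NormalCoord n × ℝ × ℝ × (Fin n → ℝ) => addNode q.1 q.2)
      ((volume.restrict (posDefCoord n)).prod (nodeMeasure n))
      (volume.restrict (posDefCoord (n + 1))) := by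
  have h := ((measurePreserving_borderCoord n).comp (measurePreserving_shear n)).restrict_preimage
    (measurableSet_posDefCoord (n + 1))
  have hset : ((fun p : NormalCoord n × ℝ × ℝ × (Fin n → ℝ) =>
      ((Fin.snoc p.1.1 p.2.1, borderCoord p.1.2 p.2.2.2 p.2.2.1) : NormalCoord (n + 1))) ∘
      (fun p : NormalCoord n × ℝ × ℝ × (Fin n → ℝ) =>
      (((p.1.1, p.1.2 + p.2.2.1⁻¹ • fun z => (z.map p.2.2.2).mul),
        (p.2.1 + (-(p.2.2.1⁻¹ • p.2.2.2)) ⬝ᵥ p.1.1, p.2.2)) :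
        NormalCoord n × ℝ × ℝ × (Fin n → ℝ)))) ⁻¹' posDefCoord (n + 1) =
      posDefCoord n ×ˢ {x : ℝ × ℝ × (Fin n → ℝ) | 0 < x.2.1} := by
    ext ⟨p, t, s, r⟩
    change (symMatrix (borderCoord (p.2 + s⁻¹ • fun z => (z.map r).mul) r s)).PosDef ↔
      (symMatrix p.2).PosDef ∧ 0 < s
    rw [symMatrix_borderCoord, symMatrix_add_vecMulVec, borderMatrix.posDef_iff,
      add_sub_cancel_right, and_comm]
  rw [hset, Measure.volume_eq_prod, ← Measure.prod_restrict] at h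
  have h' := h.comp ((MeasurePreserving.id _).prod (measurePreserving_node n))
  -- Recovering `b` as `-r / s` requires `v ≠ 0`, so the two maps are identified only almost
  -- everywhere.
  refine ⟨measurable_addNode n, (Measure.map_congr ?_).trans h'.map_eq⟩
  filter_upwards [Measure.quasiMeasurePreserving_snd.ae (ae_nodeMeasure_pos n)] with q hq
  exact addNode_eq q.1 q.2.1 hq q.2.2.2

/-! ### Lebesgue measure through the whole network -/

theorem measurePreserving_finSnoc {n : ℕ} {E : Fin (n + 1) → Type*}
    {mE : ∀ i, MeasurableSpace (E i)} (κ : (i : Fin (n + 1)) → Measure (E i))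
    [∀ i, SigmaFinite (κ i)] :
    MeasurePreserving
      (fun p : ((i : Fin n) → E i.castSucc) × E (Fin.last n) =>
        (Fin.snoc p.1 p.2 : (i : Fin (n + 1)) → E i))
      ((Measure.pi fun i : Fin n => κ i.castSucc).prod (κ (Fin.last n))) (Measure.pi κ) := by
  have hm : Measurable (fun p : ((i : Fin n) → E i.castSucc) × E (Fin.last n) =>
      (Fin.snoc p.1 p.2 : (i : Fin (n + 1)) → E i)) := by
    refine measurable_pi_lambda _ fun i => ?_
    refine Fin.lastCases ?_ (fun i => ?_) i
    · simpa using measurable_snd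
    · simpa using (measurable_pi_apply i).fun_comp measurable_fst
  refine ⟨hm, (Measure.pi_eq fun s hs => ?_).symm⟩
  rw [Measure.map_apply hm (.univ_pi hs), Fin.prod_univ_castSucc,
    ← Measure.pi_pi, ← Measure.prod_prod]
  congr 1
  ext p
  simp [Fin.forall_fin_succ']

/-- The mean and the free coordinates of the precision matrix with regression parameters `θ`. -/
noncomputable def netCoord : (n : ℕ) → NetParam n → NormalCoord n
  | 0, _ => (0, 0)
  | n + 1, θ => addNode (netCoord n fun i => θ i.castSucc) (θ (Fin.last n))

theorem netCoord_succ_fst {n : ℕ} (θ : NetParam (n + 1)) :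
    (netCoord (n + 1) θ).1 = Fin.snoc (netCoord n fun i => θ i.castSucc).1
      (θ.m (Fin.last n) +
        dotProduct (m := Fin n) (θ.b (Fin.last n)) (netCoord n fun i => θ i.castSucc).1) :=
  rfl

theorem netCoord_snoc {n : ℕ} (θ : NetParam n) (x : ℝ × ℝ × (Fin n → ℝ)) :
    netCoord (n + 1) (Fin.snoc (α := fun i : Fin (n + 1) => NodeParam i) θ x) =
      addNode (netCoord n θ) x := by
  simp only [netCoord, Fin.snoc_castSucc, Fin.snoc_last]

theorem measurable_netCoord (n : ℕ) : Measurable (netCoord n) := by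
  induction n with
  | zero => exact measurable_const
  | succ n ih =>
    refine (measurable_addNode n).comp ((ih.comp ?_).prodMk (measurable_pi_apply (Fin.last n)))
    exact measurable_pi_lambda _ fun i => measurable_pi_apply i.castSucc

theorem measurePreserving_netCoord (n : ℕ) :
    MeasurePreserving (netCoord n) (Measure.pi fun i : Fin n => nodeMeasure i)
      (volume.restrict (posDefCoord n)) := by
  induction n with
  | zero =>
    refine ⟨measurable_netCoord 0, ?_⟩
    -- There is no nonzero vector to test, so the empty matrix is positive definite; both measures
    -- are then the unit mass on a one-point space.
    have hpos : posDefCoord 0 = Set.univ := by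
      refine Set.eq_univ_of_forall fun p => ?_
      refine Matrix.posDef_iff_dotProduct_mulVec.2 ⟨isHermitian_symMatrix _, fun x hx => ?_⟩
      exact absurd (Subsingleton.elim x 0) hx
    rw [hpos, Measure.restrict_univ]
    ext s hs
    rcases s.eq_empty_or_nonempty with rfl | hne
    · simp
    · obtain rfl := Subsingleton.eq_univ_of_nonempty hne
      rw [Measure.map_apply (measurable_netCoord 0) hs, Set.preimage_univ, Measure.volume_eq_prod,
        Measure.prod_apply MeasurableSet.univ]
      simp [volume_pi]
  | succ n ih =>
    have h := measurePreserving_finSnoc (E := fun i : Fin (n + 1) => NodeParam i)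
      fun i => nodeMeasure i
    refine ⟨measurable_netCoord _, ?_⟩
    rw [← h.map_eq, Measure.map_map (measurable_netCoord _) h.measurable]
    have h' := (measurePreserving_addNode n).comp
      (ih.prod (MeasurePreserving.id (nodeMeasure n)))
    rw [← h'.map_eq]
    congr 1
    ext1 p
    exact netCoord_snoc p.1 p.2

/-! ### The recursion and uniqueness of the regression parameters -/

theorem precisionOfRegression_succ (n : ℕ) (v : Fin (n + 1) → ℝ)
    (b : (i : Fin (n + 1)) → Fin (i : ℕ) → ℝ) :
    precisionOfRegression (n + 1) v b =
      borderMatrix (precisionOfRegression n (fun i => v i.castSucc) (fun i => b i.castSucc) +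
        (v (Fin.last n))⁻¹ • Matrix.vecMulVec (m := Fin n) (n := Fin n) (b (Fin.last n)) (b (Fin.last n)))
        (-((v (Fin.last n))⁻¹ • b (Fin.last n))) (v (Fin.last n))⁻¹ :=
  rfl

theorem symMatrix_netCoord {n : ℕ} (θ : NetParam n) :
    symMatrix (netCoord n θ).2 = precisionOfRegression n θ.v θ.b := by
  induction n with
  | zero => exact Subsingleton.elim _ _
  | succ n ih =>
    rw [precisionOfRegression_succ, netCoord, addNode, symMatrix_borderCoord,
      symMatrix_add_vecMulVec, ih]
    rfl

/-- The system is triangular: the first `n` equations do not involve the last mean, and the last one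
then determines it. -/
theorem mean_eq_iff {n : ℕ} (θ : NetParam n) (μ : Fin n → ℝ) :
    (∀ i, μ i = θ.m i + ∑ j : Fin (i : ℕ), θ.b i j * μ (Fin.castLE i.isLt.le j)) ↔
      (netCoord n θ).1 = μ := by
  induction n with
  | zero => exact ⟨fun _ => Subsingleton.elim _ _, fun _ i => i.elim0⟩
  | succ n ih =>
    have h := ih (fun i => θ i.castSucc) (fun i => μ i.castSucc)
    rw [Fin.forall_fin_succ', netCoord_succ_fst]
    have h' : (∀ i : Fin n, μ i.castSucc = θ.m i.castSucc + ∑ j : Fin (i.castSucc : ℕ),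
        θ.b i.castSucc j * μ (Fin.castLE i.castSucc.isLt.le j)) ↔
        (netCoord n fun i => θ i.castSucc).1 = fun i => μ i.castSucc := h
    rw [h']
    constructor
    · rintro ⟨h₁, h₂⟩
      ext i
      refine Fin.lastCases ?_ (fun i => ?_) i
      · rw [Fin.snoc_last, h₂, h₁]
        rfl
      · rw [Fin.snoc_castSucc, h₁]
    · intro h₁
      have h₂ : (netCoord n fun i => θ i.castSucc).1 = fun i => μ i.castSucc := by
        ext i
        rw [← h₁, Fin.snoc_castSucc]
      refine ⟨h₂, ?_⟩
      conv_lhs => rw [← h₁, Fin.snoc_last, h₂]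
      rfl

/-- The regression parameters all of whose conditional variances are positive. -/
def posNet (n : ℕ) : Set (NetParam n) := {θ | ∀ i, 0 < θ.v i}

theorem measurableSet_posNet (n : ℕ) : MeasurableSet (posNet n) := by
  have h : posNet n = ⋂ i, {θ | 0 < (θ i).2.1} := by
    ext θ
    simp [posNet, NetParam.v]
  rw [h]
  exact .iInter fun i => measurableSet_lt measurable_const (measurable_pi_apply i).snd.fst

/-- The mean and the precision matrix with regression parameters `θ`. -/
noncomputable def netNormal (n : ℕ) (θ : NetParam n) : (Fin n → ℝ) × Matrix (Fin n) (Fin n) ℝ :=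
  ((netCoord n θ).1, symMatrix (netCoord n θ).2)

theorem isRegressionParam_iff {n : ℕ} (μ : Fin n → ℝ) (W : Matrix (Fin n) (Fin n) ℝ)
    (θ : NetParam n) : IsRegressionParam μ W θ ↔ θ ∈ posNet n ∧ netNormal n θ = (μ, W) := by
  rw [netNormal, Prod.mk_inj, ← mean_eq_iff, symMatrix_netCoord]
  exact ⟨fun h => ⟨h.v_pos, h.mean_eq, h.precision_eq.symm⟩,
    fun h => ⟨h.1, h.2.1, h.2.2.symm⟩⟩

/-- The last step can be undone: the corner gives `v`, the last column then gives `b`, subtracting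
`b b' / v` gives the previous matrix, and the last mean gives `m`. -/
theorem netNormal_injOn (n : ℕ) : Set.InjOn (netNormal n) (posNet n) := by
  induction n with
  | zero => exact fun _ _ _ _ _ => Subsingleton.elim _ _
  | succ n ih =>
    intro θ hθ θ' hθ' h
    obtain ⟨hμ, hW⟩ := Prod.mk_inj.1 h
    rw [netCoord_succ_fst, netCoord_succ_fst] at hμ
    rw [netCoord, netCoord, addNode, addNode] at hW
    simp only [symMatrix_borderCoord, symMatrix_add_vecMulVec] at hW
    have hv : (θ (Fin.last n)).2.1 = (θ' (Fin.last n)).2.1 := by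
      have := congrFun (congrFun hW (Fin.last n)) (Fin.last n)
      rw [borderMatrix.last_last, borderMatrix.last_last] at this
      exact inv_injective this
    have hvpos : 0 < (θ' (Fin.last n)).2.1 := hθ' (Fin.last n)
    have hb : (θ (Fin.last n)).2.2 = (θ' (Fin.last n)).2.2 := by
      funext i
      have := congrFun (congrFun hW (Fin.castSucc i)) (Fin.last n)
      rw [borderMatrix.castSucc_last, borderMatrix.castSucc_last, hv] at this
      simpa [hvpos.ne'] using this
    have hW' : symMatrix (netCoord n fun i => θ i.castSucc).2 =
        symMatrix (netCoord n fun i => θ' i.castSucc).2 := by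
      ext i j
      have := congrFun (congrFun hW i.castSucc) j.castSucc
      rw [borderMatrix.castSucc_castSucc, borderMatrix.castSucc_castSucc, hv, hb] at this
      simpa using this
    have hμ' : (netCoord n fun i => θ i.castSucc).1 = (netCoord n fun i => θ' i.castSucc).1 := by
      ext i
      simpa using congrFun hμ i.castSucc
    have hm : (θ (Fin.last n)).1 = (θ' (Fin.last n)).1 := by
      have := congrFun hμ (Fin.last n)
      rw [Fin.snoc_last, Fin.snoc_last, hμ', NetParam.b, hb] at this
      exact add_right_cancel this
    have hinit := ih (fun i => hθ i.castSucc) (fun i => hθ' i.castSucc)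
      (Prod.ext hμ' hW' : netNormal n (fun i => θ i.castSucc) = netNormal n fun i => θ' i.castSucc)
    ext1 i
    refine Fin.lastCases ?_ (fun i => ?_) i
    · exact Prod.ext hm (Prod.ext hv hb)
    · exact congrFun hinit i

theorem measurable_netNormal (n : ℕ) : Measurable (netNormal n) := by
  refine (measurable_netCoord n).fst.prodMk ?_
  refine measurable_pi_lambda _ fun i => measurable_pi_lambda _ fun j => ?_
  exact (measurable_pi_apply s(i, j)).comp (measurable_netCoord n).snd

/-! ### Factorization of the normal–Wishart density -/

/-- The deviation of the intercept from the one determined by the mean vector `μ₀`. -/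
noncomputable def nodeShift {n : ℕ} (μ₀ : Fin n → ℝ) (i : Fin n) (x : NodeParam i) : ℝ :=
  x.1 + ∑ j, x.2.2 j * μ₀ (Fin.castLE i.isLt.le j) - μ₀ i

/-- The value of the quadratic form of `T` at the vector with last nonzero entry `-1` at `i` and
entries `b` before it. -/
noncomputable def nodeQuad {n : ℕ} (T : Matrix (Fin n) (Fin n) ℝ) (i : Fin n)
    (b : Fin (i : ℕ) → ℝ) : ℝ :=
  ∑ j, ∑ k, T (Fin.castLE i.isLt.le j) (Fin.castLE i.isLt.le k) * (b k * b j) -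
    ∑ j, (T i (Fin.castLE i.isLt.le j) + T (Fin.castLE i.isLt.le j) i) * b j + T i i

/-- Each bordering adds `v⁻¹` times the square of the last deviation minus its regression on the
earlier deviations. In that residual the earlier means cancel, leaving a function of the parameters
of one node. -/
theorem quadForm_netCoord {n : ℕ} (μ₀ : Fin n → ℝ) (θ : NetParam n) :
    ((netCoord n θ).1 - μ₀) ⬝ᵥ
        (precisionOfRegression n θ.v θ.b).mulVec ((netCoord n θ).1 - μ₀) =
      ∑ i, (θ.v i)⁻¹ * nodeShift μ₀ i (θ i) ^ 2 := by
  induction n with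
  | zero => simp
  | succ n ih =>
    have h := ih (fun i => μ₀ i.castSucc) (fun i => θ i.castSucc)
    let μ : Fin n → ℝ := (netCoord n fun i => θ i.castSucc).1
    let ξ : Fin n → ℝ := μ - fun i => μ₀ i.castSucc
    let b : Fin n → ℝ := θ.b (Fin.last n)
    let y : ℝ := θ.m (Fin.last n) + b ⬝ᵥ μ - μ₀ (Fin.last n)
    have hsub : (netCoord (n + 1) θ).1 - μ₀ = Fin.snoc ξ y := by
      rw [netCoord_succ_fst]
      ext i
      refine Fin.lastCases ?_ (fun i => ?_) i
      · rw [Pi.sub_apply, Fin.snoc_last, Fin.snoc_last]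
      · rw [Pi.sub_apply, Fin.snoc_castSucc, Fin.snoc_castSucc]
        rfl
    -- The terms `b ⬝ᵥ μ` in `y` and in `b ⬝ᵥ ξ` cancel.
    have hshift : nodeShift μ₀ (Fin.last n) (θ (Fin.last n)) = y - b ⬝ᵥ ξ := by
      have : b ⬝ᵥ ξ = b ⬝ᵥ μ - ∑ j : Fin n, b j * μ₀ j.castSucc := dotProduct_sub _ _ _
      rw [this]
      change θ.m (Fin.last n) + ∑ j : Fin n, b j * μ₀ j.castSucc - μ₀ (Fin.last n) = _
      simp only [y]
      ring
    rw [hsub, precisionOfRegression_succ, borderMatrix.dotProduct_mulVec, Matrix.add_mulVec,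
      Matrix.smul_mulVec, dotProduct_add, dotProduct_smul,
      borderMatrix.dotProduct_vecMulVec_mulVec, Fin.sum_univ_castSucc, hshift, neg_dotProduct,
      smul_dotProduct]
    have h' : ξ ⬝ᵥ (precisionOfRegression n (fun i => θ.v i.castSucc)
        fun i => θ.b i.castSucc).mulVec ξ =
      ∑ i : Fin n, (θ.v i.castSucc)⁻¹ * nodeShift μ₀ i.castSucc (θ i.castSucc) ^ 2 := h
    rw [h']
    simp only [smul_eq_mul, b]
    ring

/-- Each step adds the rank-one matrix `v⁻¹ u u'` with `u = (-b, 1)`, which contributes `v⁻¹` times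
the form of `T` at `u`. -/
theorem trace_mul_precisionOfRegression {n : ℕ} (T : Matrix (Fin n) (Fin n) ℝ) (θ : NetParam n) :
    (T * precisionOfRegression n θ.v θ.b).trace =
      ∑ i, (θ.v i)⁻¹ * nodeQuad T i (θ.b i) := by
  induction n with
  | zero => simp
  | succ n ih =>
    let T' : Matrix (Fin n) (Fin n) ℝ := Matrix.of fun i j => T i.castSucc j.castSucc
    let b : Fin n → ℝ := θ.b (Fin.last n)
    have h : (T' * precisionOfRegression n (fun i => θ.v i.castSucc)
        fun i => θ.b i.castSucc).trace =
        ∑ i : Fin n, (θ.v i.castSucc)⁻¹ * nodeQuad T i.castSucc (θ.b i.castSucc) :=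
      ih T' (fun i => θ i.castSucc)
    have hquad : nodeQuad T (Fin.last n) (θ.b (Fin.last n)) =
        (T' * Matrix.vecMulVec b b).trace -
          ∑ i : Fin n, (T (Fin.last n) i.castSucc + T i.castSucc (Fin.last n)) * b i +
          T (Fin.last n) (Fin.last n) := by
      simp only [Matrix.trace, Matrix.diag_apply, Matrix.mul_apply, Matrix.vecMulVec_apply]
      rfl
    rw [precisionOfRegression_succ, borderMatrix.trace_mul, Fin.sum_univ_castSucc, hquad,
      Matrix.mul_add, Matrix.trace_add, Matrix.mul_smul, Matrix.trace_smul, h]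
    have hlin : ∑ i : Fin n, (T (Fin.last n) i.castSucc + T i.castSucc (Fin.last n)) *
        (-((θ.v (Fin.last n))⁻¹ • b)) i = -((θ.v (Fin.last n))⁻¹ *
        ∑ i : Fin n, (T (Fin.last n) i.castSucc + T i.castSucc (Fin.last n)) * b i) := by
      rw [Finset.mul_sum, ← Finset.sum_neg_distrib]
      refine Finset.sum_congr rfl fun i _ => ?_
      simp only [Pi.neg_apply, Pi.smul_apply, smul_eq_mul]
      ring
    refine (congrArg₂ (· + ·) (congrArg₂ (· + ·) rfl hlin) rfl).trans ?_
    simp only [smul_eq_mul, b, T']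
    ring

theorem det_precisionOfRegression {n : ℕ} (v : Fin n → ℝ) (b : (i : Fin n) → Fin (i : ℕ) → ℝ)
    (hv : ∀ i, 0 < v i) : (precisionOfRegression n v b).det = ∏ i, (v i)⁻¹ := by
  induction n with
  | zero => simp
  | succ n ih =>
    have hc : (v (Fin.last n))⁻¹ ≠ 0 := inv_ne_zero (hv _).ne'
    -- Rewrites `b b' / v` as `s⁻¹ r r'` with `s = 1/v`, `r = -b/v`, the shape in
    -- `borderMatrix.det_add`.
    have h : (v (Fin.last n))⁻¹ •
        Matrix.vecMulVec (m := Fin n) (n := Fin n) (b (Fin.last n)) (b (Fin.last n)) =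
        ((v (Fin.last n))⁻¹)⁻¹ • Matrix.vecMulVec (m := Fin n) (n := Fin n)
          (-((v (Fin.last n))⁻¹ • b (Fin.last n))) (-((v (Fin.last n))⁻¹ • b (Fin.last n))) := by
      ext i j
      simp only [Matrix.smul_apply, Matrix.vecMulVec_apply, Pi.neg_apply, Pi.smul_apply,
        smul_eq_mul]
      field_simp
    rw [precisionOfRegression_succ, h, borderMatrix.det_add _ _ _ hc,
      ih _ _ fun i => hv i.castSucc, Fin.prod_univ_castSucc, mul_comm]

/-- The factor that the parameters `x` of node `i` contribute to the normal–Wishart density. -/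
noncomputable def nodeDensity {n : ℕ} (μ₀ : Fin n → ℝ) (αμ αW : ℝ)
    (T₀ : Matrix (Fin n) (Fin n) ℝ) (i : Fin n) (x : NodeParam i) : ℝ :=
  x.2.1⁻¹ ^ (1 / 2 : ℝ) * x.2.1⁻¹ ^ ((αW - (n : ℝ) - 1) / 2) *
    Real.exp (-(1 / 2) * (x.2.1⁻¹ * (αμ * nodeShift μ₀ i x ^ 2 + nodeQuad T₀ i x.2.2)))

theorem normalDensity_mul_wishartDensity_netCoord {n : ℕ} (μ₀ : Fin n → ℝ) (αμ αW : ℝ)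
    (hαμ : 0 < αμ) (T₀ : Matrix (Fin n) (Fin n) ℝ) (θ : NetParam n) (hθ : θ ∈ posNet n) :
    normalDensity μ₀ (αμ • symMatrix (netCoord n θ).2) (netCoord n θ).1 *
        wishartDensity αW T₀ (symMatrix (netCoord n θ).2) =
      (2 * Real.pi) ^ (-(n : ℝ) / 2) * (αμ ^ n) ^ (1 / 2 : ℝ) * wishartConst αW T₀ *
        ∏ i, nodeDensity μ₀ αμ αW T₀ i (θ i) := by
  have hinv : ∀ i ∈ Finset.univ, 0 ≤ (θ.v i)⁻¹ := fun i _ => inv_nonneg.2 (hθ i).le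
  rw [normalDensity, wishartDensity, symMatrix_netCoord, Matrix.det_smul, Fintype.card_fin,
    det_precisionOfRegression _ _ hθ, trace_mul_precisionOfRegression, Matrix.smul_mulVec,
    dotProduct_smul, quadForm_netCoord, Real.mul_rpow (by positivity) (Finset.prod_nonneg hinv),
    ← Real.finsetProd_rpow _ _ hinv, ← Real.finsetProd_rpow _ _ hinv]
  simp only [nodeDensity, Finset.prod_mul_distrib, ← Real.exp_sum, ← Finset.mul_sum, mul_add,
    Real.exp_add]
  have hcomm : ∑ i, (θ i).2.1⁻¹ * (αμ * nodeShift μ₀ i (θ i) ^ 2) =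
      αμ • ∑ i, (θ.v i)⁻¹ * nodeShift μ₀ i (θ i) ^ 2 := by
    rw [smul_eq_mul, Finset.mul_sum]
    exact Finset.sum_congr rfl fun i _ => by rw [NetParam.v]; ring
  rw [hcomm]
  simp only [NetParam.v, NetParam.b]
  ring

theorem measurable_nodeDensity {n : ℕ} (μ₀ : Fin n → ℝ) (αμ αW : ℝ)
    (T₀ : Matrix (Fin n) (Fin n) ℝ) (i : Fin n) :
    Measurable (nodeDensity μ₀ αμ αW T₀ i) := by
  unfold nodeDensity nodeShift nodeQuad
  fun_prop

/-! ### The normal–Wishart distribution as the image of a product -/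

theorem withDensity_map_eq_map_withDensity {α β : Type*} [MeasurableSpace α] [MeasurableSpace β]
    {μ : Measure α} {Φ : α → β} (hΦ : Measurable Φ) {f : β → ENNReal} (hf : Measurable f) :
    (μ.map Φ).withDensity f = (μ.withDensity (f ∘ Φ)).map Φ := by
  ext s hs
  rw [withDensity_apply _ hs, setLIntegral_map hs hf hΦ, Measure.map_apply hΦ hs,
    withDensity_apply _ (hΦ hs)]
  rfl

/-- The masses of the factors multiply to `c⁻¹`, which is neither zero nor infinite; hence neither
is any single mass, and dividing each factor by its mass absorbs `c`. -/
theorem exists_smul_pi_eq_pi {n : ℕ} {E : Fin n → Type*} {mE : ∀ i, MeasurableSpace (E i)}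
    (τ : (i : Fin n) → Measure (E i)) [∀ i, SigmaFinite (τ i)] {c : ENNReal}
    (hc : (c • Measure.pi τ) Set.univ = 1) :
    ∃ r : Fin n → ENNReal, (∀ i, IsProbabilityMeasure (r i • τ i)) ∧
      c • Measure.pi τ = Measure.pi fun i => r i • τ i := by
  have hc' : c * ∏ i, τ i Set.univ = 1 := by
    rwa [Measure.smul_apply, Measure.pi_univ, smul_eq_mul] at hc
  have hprod : ∏ i, τ i Set.univ ≠ 0 := fun h => by simp [h] at hc'
  have hne (i : Fin n) : τ i Set.univ ≠ 0 := Finset.prod_ne_zero_iff.1 hprod i (Finset.mem_univ i)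
  have hc0 : c ≠ 0 := fun h => by simp [h] at hc'
  have htop (i : Fin n) : τ i Set.univ ≠ ⊤ := fun h => by
    have : ∏ j, τ j Set.univ = ⊤ := by
      rw [← Finset.mul_prod_erase _ _ (Finset.mem_univ i), h,
        ENNReal.top_mul (Finset.prod_ne_zero_iff.2 fun j _ => hne j)]
    rw [this, ENNReal.mul_top hc0] at hc'
    exact ENNReal.top_ne_one hc'
  have hprob (i : Fin n) : IsProbabilityMeasure ((τ i Set.univ)⁻¹ • τ i) :=
    ⟨by rw [Measure.smul_apply, smul_eq_mul, ENNReal.inv_mul_cancel (hne i) (htop i)]⟩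
  refine ⟨fun i => (τ i Set.univ)⁻¹, hprob, (Measure.pi_eq fun s _ => ?_).symm⟩
  rw [Measure.smul_apply, Measure.pi_pi, ENNReal.eq_inv_of_mul_eq_one_left hc',
    ENNReal.prod_inv_distrib fun i _ j _ _ => .inl (hne i)]
  simp only [Measure.smul_apply, smul_eq_mul, Finset.prod_mul_distrib]

theorem measurable_normalWishartDensity {n : ℕ} (μ₀ : Fin n → ℝ) (αμ αW : ℝ)
    (T₀ : Matrix (Fin n) (Fin n) ℝ) :
    Measurable fun p : NormalCoord n => ENNReal.ofReal
      (normalDensity μ₀ (αμ • symMatrix p.2) p.1 * wishartDensity αW T₀ (symMatrix p.2)) := by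
  have hsym : Continuous fun p : NormalCoord n => symMatrix p.2 :=
    (continuous_symMatrix n).comp continuous_snd
  have hdet : Measurable fun p : NormalCoord n => (symMatrix p.2).det :=
    hsym.matrix_det.measurable
  have hdet' : Measurable fun p : NormalCoord n => (αμ • symMatrix p.2).det :=
    (hsym.const_smul αμ).matrix_det.measurable
  have htr : Measurable fun p : NormalCoord n => (T₀ * symMatrix p.2).trace :=
    (continuous_const.matrix_mul hsym).matrix_trace.measurable
  have hquad : Measurable fun p : NormalCoord n =>
      (p.1 - μ₀) ⬝ᵥ (αμ • symMatrix p.2).mulVec (p.1 - μ₀) :=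
    (Continuous.dotProduct (by fun_prop)
      ((hsym.const_smul αμ).matrix_mulVec (by fun_prop))).measurable
  unfold normalDensity wishartDensity
  fun_prop

/-- The unnormalized distribution of the parameters of node `i`. -/
noncomputable def nodeDist {n : ℕ} (μ₀ : Fin n → ℝ) (αμ αW : ℝ) (T₀ : Matrix (Fin n) (Fin n) ℝ)
    (i : Fin n) : Measure (NodeParam i) :=
  (nodeMeasure i).withDensity fun x => ENNReal.ofReal (nodeDensity μ₀ αμ αW T₀ i x)

instance {n : ℕ} (μ₀ : Fin n → ℝ) (αμ αW : ℝ) (T₀ : Matrix (Fin n) (Fin n) ℝ) (i : Fin n) :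
    SigmaFinite (nodeDist μ₀ αμ αW T₀ i) :=
  SigmaFinite.withDensity_of_ne_top (.of_forall fun _ => ENNReal.ofReal_ne_top)

theorem nodeDist_eq_withDensity {n : ℕ} (μ₀ : Fin n → ℝ) (αμ αW : ℝ)
    (T₀ : Matrix (Fin n) (Fin n) ℝ) (i : Fin n) :
    nodeDist μ₀ αμ αW T₀ i = volume.withDensity (nodeJacobian i *
      fun x => ENNReal.ofReal (nodeDensity μ₀ αμ αW T₀ i x)) :=
  (withDensity_mul _ (measurable_nodeJacobian i)
    (measurable_nodeDensity μ₀ αμ αW T₀ i).ennreal_ofReal).symm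

theorem ae_pi_mem_posNet {n : ℕ} (ν : (i : Fin n) → Measure (NodeParam i))
    [∀ i, SigmaFinite (ν i)] (hν : ∀ i, ν i ≪ nodeMeasure i) :
    ∀ᵐ θ ∂(Measure.pi ν), θ ∈ posNet n := by
  have h : ∀ᵐ θ ∂(Measure.pi ν), ∀ i : Fin n, 0 < (θ i).2.1 := by
    refine ae_all_iff.2 fun i => ?_
    exact Measure.tendsto_eval_ae_ae.eventually ((hν i).ae_le (ae_nodeMeasure_pos i))
  exact h

theorem normalWishart_eq_map {n : ℕ} (μ₀ : Fin n → ℝ) (αμ αW : ℝ) (hαμ : 0 < αμ)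
    (T₀ : Matrix (Fin n) (Fin n) ℝ) : ∃ c : ENNReal,
    normalWishart μ₀ αμ αW T₀ =
      (c • Measure.pi (nodeDist μ₀ αμ αW T₀)).map (netNormal n) := by
  set C : ℝ := (2 * Real.pi) ^ (-(n : ℝ) / 2) * (αμ ^ n) ^ (1 / 2 : ℝ) * wishartConst αW T₀
    with hC
  refine ⟨ENNReal.ofReal C, ?_⟩
  have hf := measurable_normalWishartDensity μ₀ αμ αW T₀
  have hcoord : normalWishartCoord μ₀ αμ αW T₀ =
      (ENNReal.ofReal C • Measure.pi (nodeDist μ₀ αμ αW T₀)).map (netCoord n) := by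
    have hg (i : Fin n) := (measurable_nodeDensity μ₀ αμ αW T₀ i).ennreal_ofReal
    rw [normalWishartCoord]
    refine (withDensity_indicator (measurableSet_posDefCoord n) _).trans ?_
    rw [← (measurePreserving_netCoord n).map_eq,
      withDensity_map_eq_map_withDensity (measurable_netCoord n) hf]
    congr 1
    have (i : Fin n) : SigmaFinite ((nodeMeasure i).withDensity
        fun x => ENNReal.ofReal (nodeDensity μ₀ αμ αW T₀ i x)) :=
      inferInstanceAs (SigmaFinite (nodeDist μ₀ αμ αW T₀ i))
    have hpi : Measure.pi (nodeDist μ₀ αμ αW T₀) = _ :=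
      pi_withDensity_eq (fun i : Fin n => nodeMeasure i) hg
    have hprodm : Measurable fun θ : NetParam n =>
        ∏ i, ENNReal.ofReal (nodeDensity μ₀ αμ αW T₀ i (θ i)) :=
      Finset.measurable_prod _ fun i _ => (hg i).comp (measurable_pi_apply i)
    rw [hpi, ← withDensity_smul _ hprodm]
    -- The factorization of the density needs all `v_i > 0`, which holds almost everywhere for the
    -- product of the node measures.
    refine withDensity_congr_ae ?_
    filter_upwards [ae_pi_mem_posNet (fun i : Fin n => nodeMeasure i) fun i =>
      Measure.AbsolutelyContinuous.rfl] with θ hθ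
    have hnonneg : ∀ i ∈ Finset.univ, 0 ≤ nodeDensity μ₀ αμ αW T₀ i (θ i) := fun i _ =>
      mul_nonneg (mul_nonneg (Real.rpow_nonneg (inv_nonneg.2 (hθ i).le) _)
        (Real.rpow_nonneg (inv_nonneg.2 (hθ i).le) _)) (Real.exp_pos _).le
    rw [Function.comp_apply, normalDensity_mul_wishartDensity_netCoord μ₀ αμ αW hαμ T₀ θ hθ,
      ← hC, ENNReal.ofReal_mul' (Finset.prod_nonneg hnonneg),
      ENNReal.ofReal_prod_of_nonneg hnonneg]
    rfl
  have hsym : Measurable fun p : NormalCoord n => (p.1, symMatrix p.2) :=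
    measurable_fst.prodMk (measurable_pi_lambda _ fun i => measurable_pi_lambda _ fun j =>
      (measurable_pi_apply s(i, j)).comp measurable_snd)
  rw [normalWishart, hcoord, Measure.map_map hsym (measurable_netCoord n)]
  rfl

/-! ### Measurable inversion and the conclusion -/

/-- Lusin–Souslin: an injective measurable map between standard Borel spaces is a measurable
embedding. -/
theorem exists_measurable_leftInverse_netNormal (n : ℕ) :
    MeasurableSet (netNormal n '' posNet n) ∧
      ∃ H : (Fin n → ℝ) × Matrix (Fin n) (Fin n) ℝ → NetParam n,
        Measurable H ∧ ∀ θ ∈ posNet n, H (netNormal n θ) = θ := by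
  have : StandardBorelSpace (posNet n) := (measurableSet_posNet n).standardBorel
  have : StandardBorelSpace (Matrix (Fin n) (Fin n) ℝ) :=
    inferInstanceAs (StandardBorelSpace (Fin n → Fin n → ℝ))
  have hemb : MeasurableEmbedding ((posNet n).domRestrict (netNormal n)) :=
    ((measurable_netNormal n).comp measurable_subtype_coe).measurableEmbedding
      (netNormal_injOn n).injective
  refine ⟨Set.range_domRestrict (netNormal n) (posNet n) ▸ hemb.measurableSet_range, ?_⟩
  obtain ⟨H, hH, hH'⟩ := hemb.exists_measurable_extend
    (g := fun θ : posNet n => (θ : NetParam n)) measurable_subtype_coe fun _ => inferInstance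
  exact ⟨H, hH, fun θ hθ => congrFun hH' ⟨θ, hθ⟩⟩

theorem theorem7 {Ω : Type*} [MeasurableSpace Ω] (P : Measure Ω) [IsProbabilityMeasure P]
    (n : ℕ) (μ₀ : Fin n → ℝ) (αμ αW : ℝ) (T₀ : Matrix (Fin n) (Fin n) ℝ)
    (hαμ : 0 < αμ) (hαW : (n : ℝ) - 1 < αW) (hT₀ : T₀.PosDef)
    (μ : Ω → Fin n → ℝ) (W : Ω → Matrix (Fin n) (Fin n) ℝ)
    (hμW : HasLaw (fun ω => (μ ω, W ω)) (normalWishart μ₀ αμ αW T₀) P) :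
    (∀ᵐ ω ∂P, ∃! θ : NetParam n, IsRegressionParam (μ ω) (W ω) θ) ∧
    ∀ Θ : Ω → NetParam n, (∀ᵐ ω ∂P, IsRegressionParam (μ ω) (W ω) (Θ ω)) →
      iIndepFun (fun (i : Fin n) (ω : Ω) => Θ ω i) P ∧
      HasPDF Θ P volume ∧
      (∀ i : Fin n, HasPDF (fun ω => Θ ω i) P volume) ∧
      pdf Θ P volume =ᵐ[volume]
        fun t : NetParam n => ∏ i : Fin n, pdf (fun ω => Θ ω i) P volume (t i) := by
  obtain ⟨c, hc⟩ := normalWishart_eq_map μ₀ αμ αW hαμ T₀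
  have hmeas := measurable_netNormal n
  have hlaw := hμW.map_eq
  rw [hc] at hlaw
  -- The mass is inherited from `P` through the law of `(μ, W)`.
  have hmass : (c • Measure.pi (nodeDist μ₀ αμ αW T₀)) Set.univ = 1 := by
    have := Measure.isProbabilityMeasure_map (μ := P) hμW.aemeasurable
    rw [← Set.preimage_univ (f := netNormal n), ← Measure.map_apply hmeas .univ, ← hlaw,
      measure_univ]
  obtain ⟨r, hr, hpi⟩ := exists_smul_pi_eq_pi _ hmass
  set ν : (i : Fin n) → Measure (NodeParam i) := fun i => r i • nodeDist μ₀ αμ αW T₀ i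
  let h (i : Fin n) : NodeParam i → ENNReal := r i • (nodeJacobian i *
    fun x => ENNReal.ofReal (nodeDensity μ₀ αμ αW T₀ i x))
  have hh (i : Fin n) : Measurable (h i) := ((measurable_nodeJacobian i).mul
    (measurable_nodeDensity μ₀ αμ αW T₀ i).ennreal_ofReal).const_smul _
  have hν (i : Fin n) : ν i = volume.withDensity (h i) := by
    rw [withDensity_smul _ ((measurable_nodeJacobian i).mul
      (measurable_nodeDensity μ₀ αμ αW T₀ i).ennreal_ofReal), ← nodeDist_eq_withDensity]
  have hpos : ∀ᵐ θ ∂(Measure.pi ν), θ ∈ posNet n := ae_pi_mem_posNet ν fun i =>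
    (Measure.smul_absolutelyContinuous).trans (withDensity_absolutelyContinuous _ _)
  rw [hpi] at hlaw
  obtain ⟨himg, H, hH, hH'⟩ := exists_measurable_leftInverse_netNormal n
  refine ⟨?_, fun Θ hΘ => ?_⟩
  · have hmem : ∀ᵐ q ∂(P.map fun ω => (μ ω, W ω)), q ∈ netNormal n '' posNet n := by
      rw [hlaw]
      refine (ae_map_iff hmeas.aemeasurable himg).2 ?_
      exact hpos.mono fun θ hθ => Set.mem_image_of_mem _ hθ
    filter_upwards [ae_of_ae_map hμW.aemeasurable hmem] with ω ⟨θ, hθ, hθ'⟩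
    refine ⟨θ, (isRegressionParam_iff _ _ _).2 ⟨hθ, hθ'⟩, fun θ' h' => ?_⟩
    obtain ⟨h₁, h₂⟩ := (isRegressionParam_iff _ _ _).1 h'
    exact netNormal_injOn n h₁ hθ (h₂.trans hθ'.symm)
  -- `Θ` is not assumed measurable; agreeing almost surely with a measurable function of `(μ, W)`
  -- makes it so up to a null set and determines its law.
  · have hΘH : Θ =ᵐ[P] fun ω => H (μ ω, W ω) := by
      filter_upwards [hΘ] with ω hω
      obtain ⟨h₁, h₂⟩ := (isRegressionParam_iff _ _ _).1 hω
      rw [← h₂, hH' _ h₁]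
    have hΘm : AEMeasurable Θ P := (hH.comp_aemeasurable hμW.aemeasurable).congr hΘH.symm
    have hΘmap : P.map Θ = Measure.pi ν := by
      rw [Measure.map_congr hΘH]
      refine (AEMeasurable.map_map_of_aemeasurable hH.aemeasurable
        hμW.aemeasurable).symm.trans ?_
      rw [hlaw, Measure.map_map hH hmeas]
      refine (Measure.map_congr (g := id) ?_).trans Measure.map_id
      exact hpos.mono fun θ hθ => hH' θ hθ
    have hmi (i : Fin n) : AEMeasurable (fun ω => Θ ω i) P :=
      (measurable_pi_apply i).comp_aemeasurable hΘm
    have hmapi (i : Fin n) : P.map (fun ω => Θ ω i) = ν i := by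
      rw [← (measurePreserving_eval ν i).map_eq, ← hΘmap,
        AEMeasurable.map_map_of_aemeasurable (measurable_pi_apply i).aemeasurable hΘm]
      rfl
    have hpdfi (i : Fin n) : HasPDF (fun ω => Θ ω i) P volume :=
      hasPDF_of_map_eq_withDensity (hmi i) (h i) (hh i).aemeasurable ((hmapi i).trans (hν i))
    have hprodm : Measurable fun t : NetParam n => ∏ i, h i (t i) :=
      Finset.measurable_prod _ fun i _ => (hh i).comp (measurable_pi_apply i)
    have hΘdens : P.map Θ = volume.withDensity fun t : NetParam n => ∏ i, h i (t i) := by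
      have (i : Fin n) : SigmaFinite (volume.withDensity (h i)) := by
        rw [← hν i]
        infer_instance
      rw [hΘmap, funext hν]
      exact pi_withDensity_eq (fun _ => volume) hh
    have hpdf : HasPDF Θ P volume :=
      hasPDF_of_map_eq_withDensity hΘm _ hprodm.aemeasurable hΘdens
    refine ⟨?_, hpdf, hpdfi, ?_⟩
    · rw [iIndepFun_iff_map_fun_eq_pi_map hmi, funext hmapi]
      exact hΘmap
    · have hi : ∀ᵐ t : NetParam n, ∀ i, pdf (fun ω => Θ ω i) P volume (t i) = h i (t i) := by
        refine ae_all_iff.2 fun i => ?_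
        have := (pdf.eq_of_map_eq_withDensity (h i) (hh i).aemeasurable).1
          ((hmapi i).trans (hν i))
        exact (Measure.tendsto_eval_ae_ae (μ := fun i : Fin n =>
          (volume : Measure (NodeParam i)))).eventually this
      filter_upwards [hi, (pdf.eq_of_map_eq_withDensity _ hprodm.aemeasurable).1 hΘdens]
        with t ht ht'
      rw [ht']
      exact Finset.prod_congr rfl fun i _ => (ht i).symm
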